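/- Let $s>0$ and let $m:\mathbb R\to\mathbb R$ be continuous except at finitely many points and satisfy, for some constants $A_1,A_2>0$, $$A_1|\xi|^s\le m(\xi)\le A_2|\xi|^s\ \text{ for } |\xi|\ge 1,\qquad 0\le m(\xi)\le A_2\ \text{ for } |\xi|\le 1.$$ Let $L$ be the Fourier multiplier operator $\widehat{Lu}(\xi)=m(\xi)\widehat u(\xi)$, where $\widehat u(\xi)=\int_{\mathbb R}e^{-2\pi i x\xi}u(x)\,dx$, and for $r\ge0$ let $H^r$ be the space of $u\in L^2(\mathbb R)$ with $\int_{\mathbb R}(1+|\xi|^2)^r|\widehat u(\xi)|^2\,d\xi<\infty$. Let $1<p<\frac{1+s}{1-s}$ if $s<1$, and $1<p<\infty$ if $s\ge1$, and let $f:\mathbb R\to\mathbb R$ be either $f(x)=c_p\,x|x|^{p-1}$ with $c_p>0$, or $f(x)=c_p|x|^p$ with $c_p\ne0$. Let $c\in\mathbb R$, $c\neq0$ (in particular, $c$ may be any wave speed $c>0$). If a real-valued function $u\in H^{s/2}$ satisfies, in the sense of tempered distributions, one of the equations $$Lu+cu-f(u)=0,\qquad c(Lu+u)-f(u)=0,\qquad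 cLu+(c-1)u-f(u)=0,$$ then $u\in H^s$. -/

import Mathlib

open MeasureTheory FourierTransform
open scoped SchwartzMap

namespace SolitaryWave

/-- `m` is the symbol of a Fourier multiplier operator of order `s`: `m` is comparable to `|ξ|^s`
for `|ξ| ≥ 1`, nonnegative and bounded for `|ξ| ≤ 1`, and continuous off a finite set. -/
structure IsSymbol (s : ℝ) (m : ℝ → ℝ) : Prop where
  bounds : ∃ A₁ A₂ : ℝ, 0 < A₁ ∧ 0 < A₂ ∧
    (∀ ξ : ℝ, 1 ≤ |ξ| → A₁ * |ξ| ^ s ≤ m ξ ∧ m ξ ≤ A₂ * |ξ| ^ s) ∧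
    (∀ ξ : ℝ, |ξ| ≤ 1 → 0 ≤ m ξ ∧ m ξ ≤ A₂)
  finite_discontinuities : {ξ : ℝ | ¬ ContinuousAt m ξ}.Finite

/-- The power nonlinearities `f(x) = c_p x |x|^(p-1)` with `c_p > 0` and
`f(x) = c_p |x|^p` with `c_p ≠ 0`. -/
def IsPowerNonlinearity (p : ℝ) (f : ℝ → ℝ) : Prop :=
  (∃ cp : ℝ, 0 < cp ∧ ∀ x, f x = cp * x * |x| ^ (p - 1)) ∨
  (∃ cp : ℝ, cp ≠ 0 ∧ ∀ x, f x = cp * |x| ^ p)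

/-- A real-valued `L²` function, regarded as a complex-valued one. -/
noncomputable def complexify (u : Lp ℝ 2 (volume : Measure ℝ)) : Lp ℂ 2 (volume : Measure ℝ) :=
  Complex.ofRealCLM.compLp u

/-- `u ∈ H^r(ℝ)`, for a real-valued `u ∈ L²(ℝ)`. (For `r ≥ 0` every element of `H^r(ℝ)` is
in `L²(ℝ)`.) -/
def MemH (r : ℝ) (u : Lp ℝ 2 (volume : Measure ℝ)) : Prop :=
  TemperedDistribution.MemSobolev r 2
    (MeasureTheory.Lp.toTemperedDistribution (complexify u) : 𝓢'(ℝ, ℂ))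

/-- The Fourier transform `û` of a real-valued `u ∈ L²(ℝ)` (Plancherel extension of
`û(ξ) = ∫ e^{-2πixξ} u(x) dx`). -/
noncomputable def hat (u : Lp ℝ 2 (volume : Measure ℝ)) : Lp ℂ 2 (volume : Measure ℝ) :=
  𝓕 (complexify u)

/-- The distribution `L u`, where `L` is the Fourier multiplier operator with symbol `m`, i.e. the
inverse Fourier transform of `m û`:
`⟨L u, φ⟩ = ⟨m û, 𝓕⁻¹ φ⟩ = ∫ m(ξ) û(ξ) (𝓕⁻¹ φ)(ξ) dξ` for Schwartz functions `φ`. -/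
noncomputable def multiplier (m : ℝ → ℝ) (u : Lp ℝ 2 (volume : Measure ℝ)) (φ : 𝓢(ℝ, ℂ)) : ℂ :=
  ∫ ξ : ℝ, (m ξ : ℂ) * hat u ξ * (𝓕⁻ φ : 𝓢(ℝ, ℂ)) ξ

/-- The distribution `⟨g, φ⟩ = ∫ g(x) φ(x) dx` given by a real-valued function `g`. -/
noncomputable def pairing (g : ℝ → ℝ) (φ : 𝓢(ℝ, ℂ)) : ℂ :=
  ∫ x : ℝ, (g x : ℂ) * φ x

/-- `L u + c u - f(u) = 0` in the sense of tempered distributions. -/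
def SolvesFirst (m f : ℝ → ℝ) (c : ℝ) (u : Lp ℝ 2 (volume : Measure ℝ)) : Prop :=
  ∀ φ : 𝓢(ℝ, ℂ), multiplier m u φ + c * pairing u φ - pairing (fun x => f (u x)) φ = 0

/-- `c (L u + u) - f(u) = 0` in the sense of tempered distributions. -/
def SolvesSecond (m f : ℝ → ℝ) (c : ℝ) (u : Lp ℝ 2 (volume : Measure ℝ)) : Prop :=
  ∀ φ : 𝓢(ℝ, ℂ), c * (multiplier m u φ + pairing u φ) - pairing (fun x => f (u x)) φ = 0

/-- `c L u + (c - 1) u - f(u) = 0` in the sense of tempered distributions. -/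
def SolvesThird (m f : ℝ → ℝ) (c : ℝ) (u : Lp ℝ 2 (volume : Measure ℝ)) : Prop :=
  ∀ φ : 𝓢(ℝ, ℂ),
    c * multiplier m u φ + (c - 1) * pairing u φ - pairing (fun x => f (u x)) φ = 0

end SolitaryWave

/-!
# Solitary waves in `H^(s/2)` lie in `H^s`

All three equations have the form `(α L + β) u = f(u)` with `α ≠ 0`, and `α m + β` is elliptic of
order `s` up to a bounded error (`IsSymbol.exists_bracket_le`), so inverting it gains `s`
derivatives in `L²`-based spaces. As `m` has no regularity beyond its size, `L^q` multiplier theory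
is not available for `q ≠ 2`; the nonlinearity is instead placed in a negative Sobolev space.

If `u ∈ H^r`, then `u ∈ L^a` for every `a > 2` with `1/a > 1/2 - r`. When `a = 2p` is admissible,
`f(u) ∈ L²` and hence `u ∈ H^s`. Otherwise `r < 1/2`, hence `s < 1`, and `f(u) ∈ L^b` with
`1/b = p/a` slightly above `p (1/2 - r)` and `1 < b < 2`. The embedding of `H^σ` into the dual of
`L^b`, for `σ > 1/b - 1/2`, gives `f(u) ∈ H^(-σ)` and so `u ∈ H^(s-σ)`
(`memLp_bracket_of_equation`). The condition `p < (1 + s)/(1 - s)` says precisely that `s - σ > r`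
at `r = s/2`, and the gain grows with `r`, so finitely many steps reach `H^s` (`bootstrap_step`,
`memLp_bracket_of_solution`). Since the inequality for `p` is strict, embeddings short of the
endpoint suffice.

Those embeddings (`exists_eLpNorm_le_bracket`) follow from a decomposition into sharp dyadic
frequency shells: on the shell `|ξ| ∼ 2^j`, Bernstein's inequality and interpolation between `L²`
and `L^∞` bound the `L^q` norm by `2^(j (1/2 - 1/q))` times the `L²` norm, and the weight makes the
sum over `j` geometric. The statement that `f(u) ∈ H^(-σ)` is read off by duality from the weak
form of the equation (`memLp_bracket_neg_of_dual`).
-/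

open scoped ENNReal
open Filter Topology

namespace SolitaryWave

/-! ### The Japanese bracket -/

/-- The power `(1 + ξ²)^(r/2)` of the Japanese bracket, the Fourier weight that defines `H^r(ℝ)`. -/
noncomputable def bracket (r ξ : ℝ) : ℝ := (1 + ‖ξ‖ ^ 2) ^ (r / 2)

lemma bracket_pos (r ξ : ℝ) : 0 < bracket r ξ := by unfold bracket; positivity

lemma bracket_zero (ξ : ℝ) : bracket 0 ξ = 1 := by simp [bracket]

lemma bracket_add (r t ξ : ℝ) : bracket (r + t) ξ = bracket r ξ * bracket t ξ := by
  unfold bracket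
  rw [add_div, Real.rpow_add (by positivity)]

lemma bracket_mul_bracket_neg (r ξ : ℝ) : (bracket r ξ : ℂ) * bracket (-r) ξ = 1 := by
  rw [← Complex.ofReal_mul, ← bracket_add, add_neg_cancel, bracket_zero, Complex.ofReal_one]

lemma bracket_mono {r t : ℝ} (h : r ≤ t) (ξ : ℝ) : bracket r ξ ≤ bracket t ξ := by
  unfold bracket
  exact Real.rpow_le_rpow_of_exponent_le (by nlinarith [sq_nonneg ‖ξ‖]) (by linarith)

lemma hasTemperateGrowth_bracket (r : ℝ) :
    (fun ξ ↦ (bracket r ξ : ℂ)).HasTemperateGrowth := by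
  unfold bracket
  fun_prop

lemma continuous_bracket (r : ℝ) : Continuous (bracket r) := by
  unfold bracket
  exact Continuous.rpow_const (by fun_prop) (fun x ↦ Or.inl (by positivity))

/-- Multiplication by `(1 + ξ²)^(r/2)` as a map of Schwartz functions. -/
noncomputable def bracketMul (r : ℝ) (ψ : 𝓢(ℝ, ℂ)) : 𝓢(ℝ, ℂ) :=
  SchwartzMap.smulLeftCLM ℂ (fun ξ ↦ (bracket r ξ : ℂ)) ψ

lemma bracketMul_apply (r : ℝ) (ψ : 𝓢(ℝ, ℂ)) (ξ : ℝ) :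
    bracketMul r ψ ξ = bracket r ξ * ψ ξ := by
  simp [bracketMul, SchwartzMap.smulLeftCLM_apply_apply (hasTemperateGrowth_bracket r)]

/-- A function of at most polynomial growth in the `L²` sense: after division by a power of the
Japanese bracket it lies in `L²`. Such a function pairs with every Schwartz function. -/
def PolyL2 (G : ℝ → ℂ) : Prop := ∃ k : ℝ, MemLp (fun ξ ↦ (bracket k ξ : ℂ) * G ξ) 2

lemma PolyL2.of_memLp {G : ℝ → ℂ} (hG : MemLp G 2) : PolyL2 G :=
  ⟨0, by simpa [bracket_zero] using hG⟩

lemma PolyL2.bracket_mul {G : ℝ → ℂ} (hG : PolyL2 G) (r : ℝ) :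
    PolyL2 (fun ξ ↦ (bracket r ξ : ℂ) * G ξ) := by
  obtain ⟨k, hk⟩ := hG
  refine ⟨k - r, hk.congr_norm (hk.1.congr ?_) ?_⟩
  all_goals
    refine Filter.Eventually.of_forall fun ξ ↦ ?_
    have := bracket_add (k - r) r ξ
    rw [sub_add_cancel] at this
    simp [this, mul_assoc]

lemma PolyL2.integrable {G : ℝ → ℂ} (hG : PolyL2 G) (ψ : 𝓢(ℝ, ℂ)) :
    Integrable (fun ξ ↦ G ξ * ψ ξ) := by
  obtain ⟨k, hk⟩ := hG
  have h := MemLp.integrable_mul (p := 2) (q := 2) hk ((bracketMul (-k) ψ).memLp 2 volume)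
  refine h.congr (Filter.Eventually.of_forall fun ξ ↦ ?_)
  simp only [Pi.mul_apply, bracketMul_apply]
  linear_combination (G ξ * ψ ξ) * bracket_mul_bracket_neg k ξ

lemma PolyL2.locallyIntegrable {G : ℝ → ℂ} (hG : PolyL2 G) : LocallyIntegrable G := by
  obtain ⟨k, hk⟩ := hG
  have h2 : LocallyIntegrable (fun ξ ↦ (bracket (-k) ξ : ℂ) • ((bracket k ξ : ℂ) * G ξ)) := by
    rw [← locallyIntegrableOn_univ]
    exact (hk.locallyIntegrable (by norm_num)).locallyIntegrableOn _ |>.continuousOn_smul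
      isOpen_univ.isLocallyClosed
      (Complex.continuous_ofReal.comp (continuous_bracket _)).continuousOn
  convert h2 using 2 with ξ
  simp only [smul_eq_mul]
  linear_combination -(G ξ) * bracket_mul_bracket_neg k ξ

/-- Locally integrable functions are determined by their integrals against Schwartz functions. -/
lemma ae_eq_of_forall_schwartz {G H : ℝ → ℂ} (hG : LocallyIntegrable G)
    (hH : LocallyIntegrable H)
    (h : ∀ ψ : 𝓢(ℝ, ℂ), ∫ ξ, G ξ * ψ ξ = ∫ ξ, H ξ * ψ ξ) : G =ᵐ[volume] H := by
  refine ae_eq_of_integral_contDiff_smul_eq hG hH fun g hg hgs ↦ ?_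
  have hs : HasCompactSupport (fun x ↦ (g x : ℂ)) := hgs.comp_left Complex.ofReal_zero
  have : ∫ x, G x * (g x : ℂ) = ∫ x, H x * (g x : ℂ) :=
    h (hs.toSchwartzMap (Complex.ofRealCLM.contDiff.comp hg))
  simpa [mul_comm] using this

/-! ### Sobolev regularity as a weighted `L²` condition -/

lemma memLp_hat (u : Lp ℝ 2 (volume : Measure ℝ)) : MemLp (hat u) 2 := Lp.memLp _

lemma memH_iff (r : ℝ) (u : Lp ℝ 2 (volume : Measure ℝ)) :
    MemH r u ↔ MemLp (fun ξ ↦ (bracket r ξ : ℂ) * hat u ξ) 2 := by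
  have key (φ : 𝓢(ℝ, ℂ)) : TemperedDistribution.smulLeftCLM ℂ
      (fun x : ℝ ↦ (((1 + ‖x‖ ^ 2) ^ (r / 2) : ℝ) : ℂ))
        (𝓕 (Lp.toTemperedDistribution (complexify u) : 𝓢'(ℝ, ℂ))) φ =
      ∫ ξ, (bracket r ξ : ℂ) * hat u ξ * φ ξ := by
    rw [Lp.fourier_toTemperedDistribution_eq, TemperedDistribution.smulLeftCLM_apply_apply,
      Lp.toTemperedDistribution_apply]
    refine integral_congr_ae (Filter.Eventually.of_forall fun ξ ↦ ?_)
    change bracketMul r φ ξ • hat u ξ = _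
    rw [bracketMul_apply, smul_eq_mul]
    ring
  unfold MemH
  rw [TemperedDistribution.memSobolev_iff_exists_smulLeftCLM_fourier]
  constructor
  · rintro ⟨w, hw⟩
    have : (fun ξ ↦ (bracket r ξ : ℂ) * hat u ξ) =ᵐ[volume] w := by
      refine ae_eq_of_forall_schwartz
        ((PolyL2.of_memLp (memLp_hat u)).bracket_mul r).locallyIntegrable
        ((Lp.memLp w).locallyIntegrable (by norm_num)) fun ψ ↦ ?_
      rw [← key, hw, Lp.toTemperedDistribution_apply]
      simp [mul_comm]
    exact (memLp_congr_ae this).2 (Lp.memLp w)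
  · intro h
    refine ⟨h.toLp, ?_⟩
    ext φ
    rw [key, Lp.toTemperedDistribution_apply]
    refine integral_congr_ae ?_
    filter_upwards [h.coeFn_toLp] with ξ hξ
    rw [hξ, smul_eq_mul, mul_comm]

lemma memLp_bracket_mono {r t : ℝ} (hrt : r ≤ t) {G : ℝ → ℂ} (hG : AEStronglyMeasurable G)
    (h : MemLp (fun ξ ↦ (bracket t ξ : ℂ) * G ξ) 2) :
    MemLp (fun ξ ↦ (bracket r ξ : ℂ) * G ξ) 2 := by
  refine h.mono ((Complex.continuous_ofReal.comp
    (continuous_bracket r)).aestronglyMeasurable.mul hG) (Filter.Eventually.of_forall fun ξ ↦ ?_)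
  simp only [norm_mul, Complex.norm_real, Real.norm_eq_abs, abs_of_pos (bracket_pos _ ξ)]
  gcongr
  exact bracket_mono hrt ξ

/-! ### The Fourier transform on `L¹ ∩ L²` -/

lemma integral_fourier_mul (h : Lp ℂ 2 (volume : Measure ℝ)) (φ : 𝓢(ℝ, ℂ)) :
    ∫ x, (𝓕 h : Lp ℂ 2 (volume : Measure ℝ)) x * φ x = ∫ x, h x * (𝓕 φ : 𝓢(ℝ, ℂ)) x := by
  have := congrArg (fun D : 𝓢'(ℝ, ℂ) ↦ D φ) (Lp.fourier_toTemperedDistribution_eq h)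
  simp only [TemperedDistribution.fourier_apply, Lp.toTemperedDistribution_apply,
    smul_eq_mul] at this
  simpa [mul_comm] using this.symm

lemma integral_fourierInv_mul (h : Lp ℂ 2 (volume : Measure ℝ)) (φ : 𝓢(ℝ, ℂ)) :
    ∫ x, (𝓕⁻ h : Lp ℂ 2 (volume : Measure ℝ)) x * φ x = ∫ x, h x * (𝓕⁻ φ : 𝓢(ℝ, ℂ)) x := by
  have := congrArg (fun D : 𝓢'(ℝ, ℂ) ↦ D φ) (Lp.fourierInv_toTemperedDistribution_eq h)
  simp only [TemperedDistribution.fourierInv_apply, Lp.toTemperedDistribution_apply,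
    smul_eq_mul] at this
  simpa [mul_comm] using this.symm

/-- If the pairing of `H` with Schwartz functions is that of a Fourier integral of the integrable
function `h`, with any bilinear phase, then `H` is bounded by the `L¹` norm of `h`. -/
lemma ae_norm_le_of_integral_eq (L : ℝ →ₗ[ℝ] ℝ →ₗ[ℝ] ℝ)
    (hL : Continuous fun p : ℝ × ℝ ↦ L p.1 p.2) {h H : ℝ → ℂ} (hh : Integrable h)
    (hH : LocallyIntegrable H)
    (hHh : ∀ φ : 𝓢(ℝ, ℂ), ∫ x, H x * φ x =
      ∫ x, h x * VectorFourier.fourierIntegral 𝐞 volume L φ x) :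
    ∀ᵐ x, ‖H x‖ ≤ ∫ y, ‖h y‖ := by
  have hLf : Continuous fun p : ℝ × ℝ ↦ L.flip p.1 p.2 := hL.comp continuous_swap
  have hc : Continuous (VectorFourier.fourierIntegral 𝐞 volume L.flip h) :=
    VectorFourier.fourierIntegral_continuous Real.continuous_fourierChar hLf hh
  have : H =ᵐ[volume] VectorFourier.fourierIntegral 𝐞 volume L.flip h := by
    refine ae_eq_of_forall_schwartz hH hc.locallyIntegrable fun φ ↦ ?_
    rw [hHh]
    simpa using (VectorFourier.integral_fourierIntegral_smul_eq_flip (L := L.flip)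
      Real.continuous_fourierChar hLf hh φ.integrable).symm
  filter_upwards [this] with x hx
  rw [hx]
  exact VectorFourier.norm_fourierIntegral_le_integral_norm _ _ _ _ _

lemma ae_norm_fourier_le (h : Lp ℂ 2 (volume : Measure ℝ)) (hh : Integrable h) :
    ∀ᵐ x, ‖(𝓕 h : Lp ℂ 2 (volume : Measure ℝ)) x‖ ≤ ∫ y, ‖h y‖ :=
  ae_norm_le_of_integral_eq (innerₗ ℝ) continuous_inner hh
    ((Lp.memLp _).locallyIntegrable (by norm_num)) fun φ ↦ integral_fourier_mul h φ

lemma ae_norm_fourierInv_le (h : Lp ℂ 2 (volume : Measure ℝ)) (hh : Integrable h) :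
    ∀ᵐ x, ‖(𝓕⁻ h : Lp ℂ 2 (volume : Measure ℝ)) x‖ ≤ ∫ y, ‖h y‖ :=
  ae_norm_le_of_integral_eq (-innerₗ ℝ) continuous_inner.neg hh
    ((Lp.memLp _).locallyIntegrable (by norm_num)) fun φ ↦
      (integral_fourierInv_mul h φ).trans (by rw [SchwartzMap.fourierInv_coe]; rfl)

/-! ### A non-endpoint Sobolev embedding by dyadic decomposition -/

/-- Interpolation of `L^q` between `L²` and `L^∞`. -/
lemma eLpNorm_le_of_ae_enorm_le {F : ℝ → ℂ} {M : ℝ≥0∞} (hMt : M ≠ ∞) (hM : ∀ᵐ x, ‖F x‖ₑ ≤ M)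
    {q : ℝ} (hq : 2 < q) :
    eLpNorm F (ENNReal.ofReal q) ≤ M ^ (1 - 2 / q) * eLpNorm F 2 ^ (2 / q) := by
  have hq0 : 0 < q := by linarith
  rw [eLpNorm_eq_lintegral_rpow_enorm_toReal (by simpa using hq0) ENNReal.ofReal_ne_top,
    eLpNorm_eq_lintegral_rpow_enorm_toReal (by norm_num) (by norm_num),
    ENNReal.toReal_ofReal hq0.le, ENNReal.toReal_ofNat]
  have h1 : ∫⁻ x, ‖F x‖ₑ ^ q ≤ M ^ (q - 2) * ∫⁻ x, ‖F x‖ₑ ^ (2 : ℝ) := by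
    rw [← lintegral_const_mul' _ _ (ENNReal.rpow_ne_top_of_nonneg (by linarith) hMt)]
    refine lintegral_mono_ae ?_
    filter_upwards [hM] with x hx
    calc ‖F x‖ₑ ^ q = ‖F x‖ₑ ^ (q - 2) * ‖F x‖ₑ ^ (2 : ℝ) := by
          rw [← ENNReal.rpow_add_of_nonneg _ _ (by linarith) (by norm_num), sub_add_cancel]
      _ ≤ _ := by gcongr
  calc _ ≤ (M ^ (q - 2) * ∫⁻ x, ‖F x‖ₑ ^ (2 : ℝ)) ^ (1 / q) := by gcongr
    _ = _ := by
      rw [ENNReal.mul_rpow_of_nonneg _ _ (by positivity), ← ENNReal.rpow_mul, ← ENNReal.rpow_mul]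
      congr 2 <;> field_simp

/-- Bernstein's inequality for a function whose frequency support lies in `[-R, R]`. -/
lemma eLpNorm_le_of_frequency_support (T : Lp ℂ 2 (volume : Measure ℝ) →ₗᵢ[ℂ]
      Lp ℂ 2 (volume : Measure ℝ))
    (hT : ∀ h : Lp ℂ 2 (volume : Measure ℝ), Integrable h → ∀ᵐ x, ‖T h x‖ ≤ ∫ y, ‖h y‖)
    {q : ℝ} (hq : 2 < q) {R : ℝ} (h : Lp ℂ 2 (volume : Measure ℝ))
    (hR : ∀ᵐ ξ, R < ‖ξ‖ → h ξ = 0) :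
    eLpNorm (T h) (ENNReal.ofReal q) ≤ ENNReal.ofReal (2 * R) ^ (1 / 2 - 1 / q) * eLpNorm h 2 := by
  have hq0 : 0 < q := by linarith
  set N := eLpNorm h 2 with hN
  have hres : eLpNorm h 1 ≤ N * ENNReal.ofReal (2 * R) ^ (1 / 2 : ℝ) := by
    have hi : h =ᵐ[volume] (Metric.closedBall (0 : ℝ) R).indicator h := by
      filter_upwards [hR] with ξ hξ
      by_cases hb : ξ ∈ Metric.closedBall (0 : ℝ) R
      · simp [hb]
      · rw [Set.indicator_of_notMem hb]
        exact hξ (by simpa using hb)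
    rw [eLpNorm_congr_ae hi, eLpNorm_indicator_eq_eLpNorm_restrict measurableSet_closedBall]
    refine (eLpNorm_le_eLpNorm_mul_rpow_measure_univ (q := 2) (by norm_num)
      (Lp.aestronglyMeasurable h).restrict).trans ?_
    have : (1 / (1 : ℝ≥0∞).toReal - 1 / (2 : ℝ≥0∞).toReal) = (1 / 2 : ℝ) := by norm_num
    rw [this, Measure.restrict_apply_univ, Real.volume_closedBall]
    gcongr
    exact eLpNorm_mono_measure _ Measure.restrict_le_self
  have hNt : N ≠ ∞ := (Lp.memLp h).eLpNorm_ne_top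
  have hMt : N * ENNReal.ofReal (2 * R) ^ (1 / 2 : ℝ) ≠ ∞ := ENNReal.mul_ne_top hNt
    (ENNReal.rpow_ne_top_of_nonneg (by norm_num) ENNReal.ofReal_ne_top)
  have hint : Integrable h := by
    rw [← memLp_one_iff_integrable]
    exact ⟨Lp.aestronglyMeasurable h, hres.trans_lt hMt.lt_top⟩
  have hM : ∀ᵐ x, ‖T h x‖ₑ ≤ N * ENNReal.ofReal (2 * R) ^ (1 / 2 : ℝ) := by
    filter_upwards [hT h hint] with x hx
    refine le_trans ?_ hres
    rw [eLpNorm_one_eq_lintegral_enorm, ← ofReal_integral_norm_eq_lintegral_enorm hint,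
      ← ofReal_norm]
    exact ENNReal.ofReal_le_ofReal hx
  have hTN : eLpNorm (T h) 2 = N := by
    have := T.norm_map h
    rw [Lp.norm_def, Lp.norm_def] at this
    exact (ENNReal.toReal_eq_toReal_iff' (Lp.memLp _).eLpNorm_ne_top hNt).1 this
  refine (eLpNorm_le_of_ae_enorm_le hMt hM hq).trans (le_of_eq ?_)
  have h2q : 2 / q < 1 := by rw [div_lt_one hq0]; exact hq
  rw [hTN, ENNReal.mul_rpow_of_nonneg _ _ (by linarith), ← ENNReal.rpow_mul]
  have : (1 / 2 : ℝ) * (1 - 2 / q) = 1 / 2 - 1 / q := by ring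
  rw [this, mul_right_comm, ← ENNReal.rpow_add_of_nonneg _ _ (by linarith) (by positivity),
    sub_add_cancel, ENNReal.rpow_one, mul_comm]

/-- The dyadic frequency shells: the unit ball, and the annuli `2^j ≤ |ξ| < 2^(j+1)`. -/
def shell : ℕ → Set ℝ
  | 0 => Metric.ball 0 1
  | j + 1 => Metric.ball 0 (2 ^ (j + 1)) \ Metric.ball 0 (2 ^ j)

lemma measurableSet_shell (j : ℕ) : MeasurableSet (shell j) := by
  cases j with
  | zero => exact measurableSet_ball
  | succ j => exact measurableSet_ball.diff measurableSet_ball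

lemma norm_lt_of_mem_shell {j : ℕ} {ξ : ℝ} (h : ξ ∈ shell j) : ‖ξ‖ < 2 ^ j := by
  cases j with
  | zero => simpa [shell] using h
  | succ j => simpa [shell] using h.1

lemma le_bracket_of_mem_shell {σ : ℝ} (hσ : 0 ≤ σ) {j : ℕ} {ξ : ℝ} (h : ξ ∈ shell j) :
    (2 : ℝ) ^ (-σ) * (2 ^ σ) ^ j ≤ bracket σ ξ := by
  cases j with
  | zero =>
    have : (2 : ℝ) ^ (-σ) ≤ 1 := Real.rpow_le_one_of_one_le_of_nonpos (by norm_num) (by linarith)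
    have := bracket_mono hσ ξ
    rw [bracket_zero] at this
    simpa using by linarith
  | succ j =>
    have hj : (2 : ℝ) ^ j ≤ ‖ξ‖ := by simpa [shell] using h.2
    have e : (2 : ℝ) ^ (-σ) * (2 ^ σ) ^ (j + 1) = (((2 : ℝ) ^ j) ^ 2) ^ (σ / 2) := by
      rw [pow_succ, mul_comm, mul_assoc, ← Real.rpow_add (by norm_num), add_neg_cancel,
        Real.rpow_zero, mul_one, ← Real.rpow_natCast (2 ^ σ), ← Real.rpow_mul (by norm_num),
        ← Real.rpow_natCast _ 2, ← Real.rpow_mul (by positivity), ← Real.rpow_natCast _ j,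
        ← Real.rpow_mul (by norm_num)]
      congr 1
      push_cast
      ring
    rw [e, bracket]
    have : ((2 : ℝ) ^ j) ^ 2 ≤ ‖ξ‖ ^ 2 := by gcongr
    exact Real.rpow_le_rpow (by positivity) (by linarith) (by linarith)

/-- The part of `g` with frequencies in the `j`-th dyadic shell. -/
noncomputable def shellPiece (g : Lp ℂ 2 (volume : Measure ℝ)) (j : ℕ) :
    Lp ℂ 2 (volume : Measure ℝ) :=
  ((Lp.memLp g).indicator (measurableSet_shell j)).toLp

lemma coeFn_shellPiece (g : Lp ℂ 2 (volume : Measure ℝ)) (j : ℕ) :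
    shellPiece g j =ᵐ[volume] (shell j).indicator g := MemLp.coeFn_toLp _

lemma sum_shellPiece_ae (g : Lp ℂ 2 (volume : Measure ℝ)) (n : ℕ) :
    (∑ j ∈ Finset.range (n + 1), shellPiece g j : Lp ℂ 2 (volume : Measure ℝ)) =ᵐ[volume]
      (Metric.ball 0 (2 ^ n)).indicator g := by
  induction n with
  | zero => simpa [shell] using coeFn_shellPiece g 0
  | succ n ih =>
    rw [Finset.sum_range_succ]
    filter_upwards [ih, coeFn_shellPiece g (n + 1),
      Lp.coeFn_add (∑ j ∈ Finset.range (n + 1), shellPiece g j) (shellPiece g (n + 1))]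
      with x h1 h2 h3
    rw [h3, Pi.add_apply, h1, h2]
    by_cases hx : ‖x‖ < 2 ^ n
    · have : ‖x‖ < 2 ^ (n + 1) := hx.trans (by gcongr <;> norm_num)
      simp only [Real.norm_eq_abs] at hx this
      simp [Set.indicator, shell, hx, this]
    · simp only [Real.norm_eq_abs] at hx
      simp [Set.indicator, shell, hx]

lemma tendsto_sum_shellPiece (g : Lp ℂ 2 (volume : Measure ℝ)) :
    Tendsto (fun n ↦ ∑ j ∈ Finset.range (n + 1), shellPiece g j) atTop (𝓝 g) := by
  rw [Lp.tendsto_Lp_iff_tendsto_eLpNorm']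
  have hsq : ∫⁻ x, ‖g x‖ₑ ^ (2 : ℝ) ≠ ∞ := by
    have := (Lp.memLp g).2
    rw [eLpNorm_lt_top_iff_lintegral_rpow_enorm_lt_top (by norm_num) (by norm_num)] at this
    simpa using this.ne
  have hlim : Tendsto (fun n : ℕ ↦
      ∫⁻ x, (Metric.ball (0 : ℝ) (2 ^ n))ᶜ.indicator (fun x ↦ ‖g x‖ₑ ^ (2 : ℝ)) x) atTop
      (𝓝 (∫⁻ _ : ℝ, 0)) := by
    refine tendsto_lintegral_of_dominated_convergence' (fun x ↦ ‖g x‖ₑ ^ (2 : ℝ))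
      (fun n ↦ ((Lp.aestronglyMeasurable g).enorm.pow_const _).indicator
        measurableSet_ball.compl)
      (fun n ↦ Eventually.of_forall fun x ↦ Set.indicator_le_self _ _ x) hsq
      (Eventually.of_forall fun x ↦ ?_)
    refine tendsto_const_nhds.congr' ?_
    have : Tendsto (fun n : ℕ ↦ (2 : ℝ) ^ n) atTop atTop :=
      tendsto_pow_atTop_atTop_of_one_lt (by norm_num)
    filter_upwards [this.eventually_gt_atTop ‖x‖] with n hn
    rw [Set.indicator_of_notMem]
    simpa using hn
  have hlim' := (ENNReal.continuous_rpow_const (y := (1 / 2 : ℝ))).tendsto _ |>.comp hlim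
  simp only [lintegral_zero, ENNReal.zero_rpow_of_pos (show (0 : ℝ) < 1 / 2 by norm_num)] at hlim'
  refine hlim'.congr fun n ↦ ?_
  rw [eLpNorm_eq_lintegral_rpow_enorm_toReal (by norm_num) (by norm_num), ENNReal.toReal_ofNat]
  simp only [Function.comp]
  congr 1
  refine lintegral_congr_ae ?_
  filter_upwards [sum_shellPiece_ae g n] with x hx
  rw [Pi.sub_apply, hx]
  by_cases hb : x ∈ Metric.ball (0 : ℝ) (2 ^ n) <;> simp [Set.indicator, hb]

lemma eLpNorm_shellPiece_le {σ : ℝ} (hσ : 0 ≤ σ) (g : Lp ℂ 2 (volume : Measure ℝ)) (j : ℕ) :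
    eLpNorm (shellPiece g j) 2 ≤ ENNReal.ofReal (2 ^ σ * (2 ^ (-σ)) ^ j) *
      eLpNorm (fun ξ ↦ (bracket σ ξ : ℂ) * g ξ) 2 := by
  refine eLpNorm_le_mul_eLpNorm_of_ae_le_mul ?_ 2
  filter_upwards [coeFn_shellPiece g j] with ξ hξ
  rw [hξ]
  by_cases hs : ξ ∈ shell j
  · rw [Set.indicator_of_mem hs, norm_mul, Complex.norm_real, Real.norm_eq_abs,
      abs_of_pos (bracket_pos σ ξ), ← mul_assoc]
    refine le_mul_of_one_le_left (norm_nonneg _) ?_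
    have h2 : (2 : ℝ) ^ σ * 2 ^ (-σ) = 1 := by
      rw [← Real.rpow_add (by norm_num), add_neg_cancel, Real.rpow_zero]
    calc (1 : ℝ) = 2 ^ σ * (2 ^ (-σ)) ^ j * (2 ^ (-σ) * (2 ^ σ) ^ j) := by
          rw [show (2 : ℝ) ^ σ * (2 ^ (-σ)) ^ j * (2 ^ (-σ) * (2 ^ σ) ^ j) =
            (2 ^ σ * 2 ^ (-σ)) * (2 ^ σ * 2 ^ (-σ)) ^ j by rw [mul_pow]; ring, h2]
          simp
      _ ≤ _ := by
          gcongr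
          exact le_bracket_of_mem_shell hσ hs
  · rw [Set.indicator_of_notMem hs, norm_zero]
    positivity

lemma coeFn_finset_sum (S : Finset ℕ) (F : ℕ → Lp ℂ 2 (volume : Measure ℝ)) :
    (∑ j ∈ S, F j : Lp ℂ 2 (volume : Measure ℝ)) =ᵐ[volume] ∑ j ∈ S, (F j : ℝ → ℂ) := by
  induction S using Finset.induction_on with
  | empty => simpa using Lp.coeFn_zero ℂ 2 (volume : Measure ℝ)
  | insert j S hj ih =>
    rw [Finset.sum_insert hj, Finset.sum_insert hj]
    exact (Lp.coeFn_add _ _).trans (EventuallyEq.rfl.add ih)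

/-- The estimate `‖f‖_q ≤ C ‖f‖_{H^σ}` for `q > 2` and `σ > 1/2 - 1/q`, stated for `f = T g`, where
`T` is the Fourier transform or its inverse. Only that `T` is an isometry of `L²` and is bounded
from `L¹` to `L^∞` is used. -/
theorem exists_eLpNorm_le_bracket (T : Lp ℂ 2 (volume : Measure ℝ) →ₗᵢ[ℂ]
      Lp ℂ 2 (volume : Measure ℝ))
    (hT : ∀ h : Lp ℂ 2 (volume : Measure ℝ), Integrable h → ∀ᵐ x, ‖T h x‖ ≤ ∫ y, ‖h y‖)
    {q : ℝ} (hq : 2 < q) {σ : ℝ} (hσ : 1 / 2 - 1 / q < σ) :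
    ∃ C : ℝ≥0∞, C ≠ ∞ ∧ ∀ g : Lp ℂ 2 (volume : Measure ℝ),
      eLpNorm (T g) (ENNReal.ofReal q) ≤ C * eLpNorm (fun ξ ↦ (bracket σ ξ : ℂ) * g ξ) 2 := by
  have hq0 : 0 < q := by linarith
  set κ := 1 / 2 - 1 / q with hκ
  have hκ0 : 0 < κ := by
    have : 1 / q < 1 / 2 := one_div_lt_one_div_of_lt (by norm_num) hq
    linarith
  have hσ0 : 0 ≤ σ := by linarith
  have hr : (2 : ℝ) ^ (κ - σ) < 1 := Real.rpow_lt_one_of_one_lt_of_neg (by norm_num) (by linarith)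
  set r := ENNReal.ofReal ((2 : ℝ) ^ (κ - σ)) with hrdef
  have hr1 : r < 1 := by rw [hrdef, ← ENNReal.ofReal_one]; exact
    (ENNReal.ofReal_lt_ofReal_iff (by norm_num)).2 hr
  refine ⟨ENNReal.ofReal (2 ^ (κ + σ)) * (1 - r)⁻¹,
    ENNReal.mul_ne_top ENNReal.ofReal_ne_top (ENNReal.inv_ne_top.2 (tsub_pos_of_lt hr1).ne'),
    fun g ↦ ?_⟩
  set W := eLpNorm (fun ξ ↦ (bracket σ ξ : ℂ) * g ξ) 2
  have hpiece (j : ℕ) : eLpNorm (T (shellPiece g j)) (ENNReal.ofReal q) ≤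
      ENNReal.ofReal (2 ^ (κ + σ)) * r ^ j * W := by
    have hs : ∀ᵐ ξ, (2 : ℝ) ^ j < ‖ξ‖ → shellPiece g j ξ = 0 := by
      filter_upwards [coeFn_shellPiece g j] with ξ hξ h
      rw [hξ, Set.indicator_of_notMem]
      exact fun hm ↦ (norm_lt_of_mem_shell hm).not_gt h
    refine (eLpNorm_le_of_frequency_support T hT hq _ hs).trans ?_
    calc _ ≤ ENNReal.ofReal (2 * 2 ^ j) ^ κ * (ENNReal.ofReal (2 ^ σ * (2 ^ (-σ)) ^ j) * W) := by
          gcongr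
          exact eLpNorm_shellPiece_le hσ0 g j
      _ = _ := by
          rw [← mul_assoc, ENNReal.ofReal_rpow_of_pos (by positivity),
            ← ENNReal.ofReal_mul (by positivity), hrdef, ← ENNReal.ofReal_pow (by positivity),
            ← ENNReal.ofReal_mul (by positivity)]
          congr 2
          rw [Real.mul_rpow (by norm_num) (by positivity), Real.rpow_add (by norm_num),
            sub_eq_add_neg, Real.rpow_add (by norm_num), mul_pow,
            Real.rpow_pow_comm (by norm_num) κ]
          ring
  have hpart (n : ℕ) : eLpNorm (T (∑ j ∈ Finset.range (n + 1), shellPiece g j)) (ENNReal.ofReal q) ≤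
      ENNReal.ofReal (2 ^ (κ + σ)) * (1 - r)⁻¹ * W := by
    have hco : (T (∑ j ∈ Finset.range (n + 1), shellPiece g j) : ℝ → ℂ) =ᵐ[volume]
        ∑ j ∈ Finset.range (n + 1), (T (shellPiece g j) : ℝ → ℂ) := by
      rw [map_sum]
      exact coeFn_finset_sum _ _
    rw [eLpNorm_congr_ae hco]
    refine (eLpNorm_sum_le (fun j _ ↦ Lp.aestronglyMeasurable _) ?_).trans ?_
    · rw [← ENNReal.ofReal_one]; exact ENNReal.ofReal_le_ofReal (by linarith)
    calc _ ≤ ∑ j ∈ Finset.range (n + 1), ENNReal.ofReal (2 ^ (κ + σ)) * r ^ j * W :=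
          Finset.sum_le_sum fun j _ ↦ hpiece j
      _ = ENNReal.ofReal (2 ^ (κ + σ)) * (∑ j ∈ Finset.range (n + 1), r ^ j) * W := by
          rw [Finset.mul_sum, Finset.sum_mul]
      _ ≤ _ := by
          rw [← ENNReal.tsum_geometric]
          gcongr
          exact ENNReal.sum_le_tsum _
  have hlim : Tendsto (fun n ↦ T (∑ j ∈ Finset.range (n + 1), shellPiece g j)) atTop (𝓝 (T g)) :=
    (T.continuous.tendsto g).comp (tendsto_sum_shellPiece g)
  obtain ⟨ns, -, hns⟩ := (tendstoInMeasure_of_tendsto_Lp hlim).exists_seq_tendsto_ae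
  exact Lp.eLpNorm_le_of_ae_tendsto (u := atTop) (Eventually.of_forall fun k ↦ hpart (ns k))
    (fun k ↦ Lp.aestronglyMeasurable _) hns

/-! ### Duality with weighted `L²` -/

/-- A function whose pairing with Schwartz functions is bounded by the `L²` norm with weight
`(1 + ξ²)^(σ/2)` lies in `L²` with the inverse weight. -/
theorem memLp_bracket_neg_of_dual {G : ℝ → ℂ} (hG : PolyL2 G) (σ C : ℝ)
    (h : ∀ ψ : 𝓢(ℝ, ℂ), ‖∫ ξ, G ξ * ψ ξ‖ ≤
      C * (eLpNorm (fun ξ ↦ (bracket σ ξ : ℂ) * ψ ξ) 2).toReal) :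
    MemLp (fun ξ ↦ (bracket (-σ) ξ : ℂ) * G ξ) 2 := by
  have hG' := hG.bracket_mul (-σ)
  let D : 𝓢(ℝ, ℂ) →ₗ[ℂ] ℂ :=
    { toFun := fun ψ ↦ ∫ ξ, (bracket (-σ) ξ : ℂ) * G ξ * ψ ξ
      map_add' := fun ψ χ ↦ by
        simp only [add_apply, mul_add]
        exact integral_add (hG'.integrable ψ) (hG'.integrable χ)
      map_smul' := fun a ψ ↦ by
        simp only [smul_apply, smul_eq_mul, RingHom.id_apply]
        rw [← integral_const_mul]
        congr 1 with ξ
        ring }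
  have hD (ψ : 𝓢(ℝ, ℂ)) :
      ‖D ψ‖ ≤ C * ‖(SchwartzMap.toLpCLM ℂ ℂ 2 volume).toLinearMap ψ‖ := by
    have e1 : D ψ = ∫ ξ, G ξ * bracketMul (-σ) ψ ξ := by
      refine integral_congr_ae (Eventually.of_forall fun ξ ↦ ?_)
      simp only [bracketMul_apply]
      ring
    have e2 : (fun ξ ↦ (bracket σ ξ : ℂ) * bracketMul (-σ) ψ ξ) = ψ := by
      ext ξ
      rw [bracketMul_apply, ← mul_assoc, bracket_mul_bracket_neg, one_mul]
    have := h (bracketMul (-σ) ψ)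
    rw [← e1, e2] at this
    exact this.trans_eq (congrArg (C * ·) SchwartzMap.norm_toLp.symm)
  let E := D.extendOfNorm (SchwartzMap.toLpCLM ℂ ℂ 2 volume).toLinearMap
  let H := (InnerProductSpace.toDual ℂ (Lp ℂ 2 (volume : Measure ℝ))).symm E
  have hH (ψ : 𝓢(ℝ, ℂ)) : ∫ ξ, star (H ξ) * ψ ξ = D ψ := by
    have h1 : E (ψ.toLp 2) = D ψ := LinearMap.extendOfNorm_eq
      (e := (SchwartzMap.toLpCLM ℂ ℂ 2 volume).toLinearMap)
      (SchwartzMap.denseRange_toLpCLM ENNReal.ofNat_ne_top) ⟨C, hD⟩ ψ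
    rw [← h1, ← InnerProductSpace.toDual_symm_apply, L2.inner_def]
    refine integral_congr_ae ?_
    filter_upwards [ψ.coeFn_toLp 2 volume] with ξ hξ
    rw [hξ, RCLike.inner_apply, mul_comm]
    rfl
  have hHs : MemLp (fun ξ ↦ star (H ξ)) 2 := (Lp.memLp H).star
  have hae : (fun ξ ↦ (bracket (-σ) ξ : ℂ) * G ξ) =ᵐ[volume] fun ξ ↦ star (H ξ) :=
    ae_eq_of_forall_schwartz hG'.locallyIntegrable (hHs.locallyIntegrable (by norm_num))
      fun ψ ↦ (hH ψ).symm
  exact (memLp_congr_ae hae).2 hHs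

/-! ### Bounds for the symbol -/

namespace IsSymbol

variable {s : ℝ} {m : ℝ → ℝ}

lemma aestronglyMeasurable (hm : IsSymbol s m) : AEStronglyMeasurable m := by
  have hS := hm.finite_discontinuities
  have hc : ContinuousOn m {ξ : ℝ | ¬ ContinuousAt m ξ}ᶜ := fun ξ hξ ↦
    (not_not.1 hξ : ContinuousAt m ξ).continuousWithinAt
  have := hc.aestronglyMeasurable (μ := volume) hS.measurableSet.compl
  rwa [Measure.restrict_eq_self_of_ae_mem] at this
  exact compl_mem_ae_iff.2 (hS.measure_zero _)

lemma exists_abs_le (hs : 0 < s) (hm : IsSymbol s m) :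
    ∃ A : ℝ, 0 < A ∧ ∀ ξ, |m ξ| ≤ A * bracket s ξ := by
  obtain ⟨A₁, A₂, h₁, h₂, hb, hl⟩ := hm.bounds
  refine ⟨A₂, h₂, fun ξ ↦ ?_⟩
  rcases le_total 1 |ξ| with h | h
  · have h3 : 0 ≤ m ξ := le_trans (by positivity) (hb ξ h).1
    rw [abs_of_nonneg h3]
    refine (hb ξ h).2.trans ?_
    gcongr
    rw [bracket, Real.norm_eq_abs]
    calc |ξ| ^ s = (|ξ| ^ 2) ^ (s / 2) := by
          rw [← Real.rpow_natCast, ← Real.rpow_mul (abs_nonneg _)]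
          congr 1
          push_cast
          ring
      _ ≤ _ := Real.rpow_le_rpow (by positivity) (by linarith) (by linarith)
  · rw [abs_of_nonneg (hl ξ h).1]
    refine (hl ξ h).2.trans (le_mul_of_one_le_right h₂.le ?_)
    exact (bracket_zero ξ).symm.le.trans (bracket_mono hs.le ξ)

/-- A nontrivial affine function of the symbol is elliptic of order `s`, up to a bounded error. -/
lemma exists_bracket_le (hs : 0 < s) (hm : IsSymbol s m) {α : ℝ} (hα : α ≠ 0) (β : ℝ) :
    ∃ K : ℝ, 0 ≤ K ∧ ∀ ξ, bracket s ξ ≤ K * (|α * m ξ + β| + 1) := by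
  obtain ⟨A₁, A₂, h₁, h₂, hb, hl⟩ := hm.bounds
  have hα' : 0 < |α| := abs_pos.2 hα
  set B : ℝ := 2 ^ (s / 2) with hB
  have hB0 : 0 < B := by positivity
  refine ⟨B + B / (|α| * A₁) * (1 + |β|), by positivity, fun ξ ↦ ?_⟩
  have hx := abs_nonneg (α * m ξ + β)
  rcases le_total 1 |ξ| with h | h
  · have h3 : bracket s ξ ≤ B * |ξ| ^ s := by
      rw [bracket, Real.norm_eq_abs]
      calc (1 + |ξ| ^ 2) ^ (s / 2) ≤ (2 * |ξ| ^ 2) ^ (s / 2) :=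
            Real.rpow_le_rpow (by positivity) (by nlinarith) (by linarith)
        _ = B * |ξ| ^ s := by
          rw [Real.mul_rpow (by norm_num) (by positivity), ← Real.rpow_natCast |ξ| 2,
            ← Real.rpow_mul (abs_nonneg _)]
          congr 2
          push_cast
          ring
    have h4 : |α| * A₁ * |ξ| ^ s ≤ |α * m ξ + β| + |β| := by
      have h5 : |α * m ξ| ≤ |α * m ξ + β| + |β| := by
        have := abs_sub (α * m ξ + β) β
        rwa [add_sub_cancel_right] at this
      rw [abs_mul] at h5
      refine le_trans ?_ h5
      rw [mul_assoc]
      gcongr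
      exact (hb ξ h).1.trans (le_abs_self _)
    calc bracket s ξ ≤ B * |ξ| ^ s := h3
      _ = B / (|α| * A₁) * (|α| * A₁ * |ξ| ^ s) := by field_simp
      _ ≤ B / (|α| * A₁) * (|α * m ξ + β| + |β|) := by gcongr
      _ ≤ B / (|α| * A₁) * ((1 + |β|) * (|α * m ξ + β| + 1)) := by
          gcongr
          nlinarith [abs_nonneg β]
      _ ≤ _ := by
          have : 0 ≤ B * (|α * m ξ + β| + 1) := by positivity
          linarith
  · have h3 : bracket s ξ ≤ B := by
      rw [bracket, Real.norm_eq_abs]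
      exact Real.rpow_le_rpow (by positivity) (by nlinarith [abs_nonneg ξ]) (by linarith)
    have : 0 ≤ B / (|α| * A₁) * (1 + |β|) := by positivity
    nlinarith [mul_nonneg hB0.le hx, mul_nonneg this hx]

lemma polyL2_mul (hs : 0 < s) (hm : IsSymbol s m) {w : ℝ → ℂ} (hw : MemLp w 2) (α β : ℝ) :
    PolyL2 (fun ξ ↦ ((α * m ξ + β : ℝ) : ℂ) * w ξ) := by
  obtain ⟨A, hA, hmA⟩ := hm.exists_abs_le hs
  refine ⟨-s, hw.of_le_mul (c := |α| * A + |β|) ?_ (Eventually.of_forall fun ξ ↦ ?_)⟩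
  · exact ((Complex.continuous_ofReal.comp (continuous_bracket _)).aestronglyMeasurable).mul
      ((Complex.continuous_ofReal.comp_aestronglyMeasurable
        ((hm.aestronglyMeasurable.const_mul α).add_const β)).mul hw.1)
  · rw [norm_mul, norm_mul, Complex.norm_real, Complex.norm_real, ← mul_assoc,
      Real.norm_eq_abs, Real.norm_eq_abs, abs_of_pos (bracket_pos _ _)]
    gcongr
    have h1 : bracket (-s) ξ * bracket s ξ = 1 := by
      rw [← bracket_add, neg_add_cancel, bracket_zero]
    have h2 : 1 ≤ bracket s ξ := (bracket_zero ξ).symm.le.trans (bracket_mono hs.le ξ)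
    calc bracket (-s) ξ * |α * m ξ + β|
        ≤ bracket (-s) ξ * ((|α| * A + |β|) * bracket s ξ) := by
          refine mul_le_mul_of_nonneg_left ?_ (bracket_pos _ _).le
          calc |α * m ξ + β| ≤ |α| * |m ξ| + |β| := by
                rw [← abs_mul]; exact abs_add_le _ _
            _ ≤ |α| * (A * bracket s ξ) + |β| * bracket s ξ := by
                gcongr
                · exact hmA ξ
                · exact le_mul_of_one_le_right (abs_nonneg _) h2
            _ = _ := by ring
      _ = (|α| * A + |β|) * (bracket (-s) ξ * bracket s ξ) := by ring
      _ = _ := by rw [h1, mul_one]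

end IsSymbol

/-! ### The equation on the Fourier side -/

lemma complexify_ae (u : Lp ℝ 2 (volume : Measure ℝ)) :
    complexify u =ᵐ[volume] fun x ↦ (u x : ℂ) := Complex.ofRealCLM.coeFn_compLp u

lemma fourierInv_hat (u : Lp ℝ 2 (volume : Measure ℝ)) : 𝓕⁻ (hat u) = complexify u :=
  FourierTransform.fourierInv_fourier_eq _

lemma pairing_coe_eq (u : Lp ℝ 2 (volume : Measure ℝ)) (φ : 𝓢(ℝ, ℂ)) :
    pairing u φ = ∫ ξ, hat u ξ * (𝓕⁻ φ : 𝓢(ℝ, ℂ)) ξ := by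
  rw [← integral_fourierInv_mul, fourierInv_hat]
  refine integral_congr_ae ?_
  filter_upwards [complexify_ae u] with x hx
  rw [hx]

variable {s : ℝ} {m : ℝ → ℝ}

lemma integral_symbol_mul_hat (hs : 0 < s) (hm : IsSymbol s m)
    {α β : ℝ} {u : Lp ℝ 2 (volume : Measure ℝ)} {F : ℝ → ℝ}
    (heq : ∀ φ : 𝓢(ℝ, ℂ), α * multiplier m u φ + β * pairing u φ - pairing F φ = 0)
    (ψ : 𝓢(ℝ, ℂ)) :
    ∫ ξ, ((α * m ξ + β : ℝ) : ℂ) * hat u ξ * ψ ξ = pairing F (𝓕 ψ) := by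
  have h := heq (𝓕 ψ)
  rw [pairing_coe_eq, multiplier, FourierTransform.fourierInv_fourier_eq, sub_eq_zero] at h
  rw [← h, ← integral_const_mul, ← integral_const_mul, ← integral_add]
  · congr 1 with ξ
    push_cast
    ring
  · refine Integrable.const_mul ?_ _
    simpa using (hm.polyL2_mul hs (memLp_hat u) 1 0).integrable ψ
  · exact ((PolyL2.of_memLp (memLp_hat u)).integrable ψ).const_mul _

lemma norm_pairing_le {b q : ℝ≥0∞} [ENNReal.HolderConjugate b q] {F : ℝ → ℝ} (hF : MemLp F b)
    (φ : 𝓢(ℝ, ℂ)) : ‖pairing F φ‖ₑ ≤ eLpNorm F b * eLpNorm φ q := by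
  have hFc : MemLp (fun x ↦ (F x : ℂ)) b := hF.ofReal
  have hn : eLpNorm (fun x ↦ (F x : ℂ)) b = eLpNorm F b :=
    eLpNorm_congr_norm_ae (Eventually.of_forall fun x ↦ by simp)
  rw [← hn]
  refine le_trans ?_ (eLpNorm_smul_le_mul_eLpNorm (r := 1) φ.continuous.aestronglyMeasurable hFc.1)
  rw [eLpNorm_one_eq_lintegral_enorm]
  exact enorm_integral_le_lintegral_enorm _

/-- The gain of regularity in the equation `(α L + β) u = F`: if `F ∈ L^b` and `H^σ` embeds into
the dual space of `L^b`, then `F ∈ H^(-σ)`, and inverting the elliptic operator gives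
`u ∈ H^(s-σ)`. -/
theorem memLp_bracket_of_equation (hs : 0 < s) (hm : IsSymbol s m)
    {α β : ℝ} (hα : α ≠ 0) {u : Lp ℝ 2 (volume : Measure ℝ)} {F : ℝ → ℝ}
    (heq : ∀ φ : 𝓢(ℝ, ℂ), α * multiplier m u φ + β * pairing u φ - pairing F φ = 0)
    {b q : ℝ≥0∞} [ENNReal.HolderConjugate b q] (hF : MemLp F b) {σ : ℝ} (hσ : 0 ≤ σ)
    (hemb : ∃ C : ℝ≥0∞, C ≠ ∞ ∧ ∀ ψ : 𝓢(ℝ, ℂ), eLpNorm (𝓕 ψ : 𝓢(ℝ, ℂ)) q ≤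
      C * eLpNorm (fun ξ ↦ (bracket σ ξ : ℂ) * ψ ξ) 2) :
    MemLp (fun ξ ↦ (bracket (s - σ) ξ : ℂ) * hat u ξ) 2 := by
  obtain ⟨C, hC, hCψ⟩ := hemb
  have hG : MemLp (fun ξ ↦ (bracket (-σ) ξ : ℂ) * (((α * m ξ + β : ℝ) : ℂ) * hat u ξ)) 2 := by
    refine memLp_bracket_neg_of_dual (hm.polyL2_mul hs (memLp_hat u) α β) σ
      (eLpNorm F b * C).toReal fun ψ ↦ ?_
    rw [integral_symbol_mul_hat hs hm heq, ← ENNReal.toReal_mul, ← toReal_enorm]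
    have hfin : eLpNorm (fun ξ ↦ (bracket σ ξ : ℂ) * ψ ξ) 2 ≠ ∞ := by
      have : (fun ξ ↦ (bracket σ ξ : ℂ) * ψ ξ) = bracketMul σ ψ := by
        ext ξ; rw [bracketMul_apply]
      rw [this]
      exact ((bracketMul σ ψ).memLp 2 volume).eLpNorm_ne_top
    refine ENNReal.toReal_mono
      (ENNReal.mul_ne_top (ENNReal.mul_ne_top hF.eLpNorm_ne_top hC) hfin) ?_
    rw [mul_assoc]
    exact (norm_pairing_le hF _).trans (by gcongr; exact hCψ ψ)
  obtain ⟨K, hK, hbK⟩ := hm.exists_bracket_le hs hα β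
  refine (((hG.norm.add (memLp_hat u).norm).const_mul K)).mono
    ((Complex.continuous_ofReal.comp (continuous_bracket _)).aestronglyMeasurable.mul
      (memLp_hat u).1) (Eventually.of_forall fun ξ ↦ ?_)
  refine le_trans ?_ (le_abs_self _)
  simp only [Pi.add_apply, norm_mul, Complex.norm_real, Real.norm_eq_abs,
    abs_of_pos (bracket_pos _ ξ)]
  have h1 : bracket (-σ) ξ ≤ 1 := (bracket_mono (by linarith) ξ).trans_eq (bracket_zero ξ)
  have h0 := bracket_pos (-σ) ξ
  calc bracket (s - σ) ξ * ‖hat u ξ‖ = bracket (-σ) ξ * bracket s ξ * ‖hat u ξ‖ := by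
        rw [← bracket_add, neg_add_eq_sub]
    _ ≤ bracket (-σ) ξ * (K * (|α * m ξ + β| + 1)) * ‖hat u ξ‖ := by gcongr; exact hbK ξ
    _ = K * (bracket (-σ) ξ * (|α * m ξ + β| * ‖hat u ξ‖) + bracket (-σ) ξ * ‖hat u ξ‖) := by ring
    _ ≤ K * (bracket (-σ) ξ * (|α * m ξ + β| * ‖hat u ξ‖) + 1 * ‖hat u ξ‖) := by gcongr
    _ = _ := by rw [one_mul]

/-! ### Integrability of solutions and of the nonlinearity -/

/-- The embedding of `H^r` into `L^a` for `a > 2` and `r > 1/2 - 1/a`. -/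
lemma memLp_of_memLp_bracket {u : Lp ℝ 2 (volume : Measure ℝ)} {r a : ℝ} (ha : 2 < a)
    (hr : 1 / 2 - 1 / a < r) (h : MemLp (fun ξ ↦ (bracket r ξ : ℂ) * hat u ξ) 2) :
    MemLp u (ENNReal.ofReal a) := by
  obtain ⟨C, hC, hCg⟩ := exists_eLpNorm_le_bracket
    (Lp.fourierTransformₗᵢ ℝ ℂ).symm.toLinearIsometry ae_norm_fourierInv_le ha hr
  have h1 : eLpNorm (complexify u) (ENNReal.ofReal a) ≤
      C * eLpNorm (fun ξ ↦ (bracket r ξ : ℂ) * hat u ξ) 2 := by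
    rw [← fourierInv_hat]
    exact hCg (hat u)
  refine ⟨Lp.aestronglyMeasurable u, lt_of_le_of_lt ?_
    (h1.trans_lt (ENNReal.mul_lt_top hC.lt_top h.2))⟩
  refine (eLpNorm_congr_norm_ae ?_).le
  filter_upwards [complexify_ae u] with x hx
  rw [hx, Complex.norm_real]

/-- The embedding of `H^σ` into `L^q`, for Schwartz functions given by their Fourier transform. -/
lemma exists_eLpNorm_fourier_schwartz_le {q σ : ℝ} (hq : 2 < q) (hσ : 1 / 2 - 1 / q < σ) :
    ∃ C : ℝ≥0∞, C ≠ ∞ ∧ ∀ ψ : 𝓢(ℝ, ℂ), eLpNorm (𝓕 ψ : 𝓢(ℝ, ℂ)) (ENNReal.ofReal q) ≤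
      C * eLpNorm (fun ξ ↦ (bracket σ ξ : ℂ) * ψ ξ) 2 := by
  obtain ⟨C, hC, hCg⟩ := exists_eLpNorm_le_bracket
    (Lp.fourierTransformₗᵢ ℝ ℂ).toLinearIsometry ae_norm_fourier_le hq hσ
  refine ⟨C, hC, fun ψ ↦ ?_⟩
  have h := hCg (ψ.toLp 2)
  have h1 : eLpNorm (𝓕 ψ : 𝓢(ℝ, ℂ)) (ENNReal.ofReal q) =
      eLpNorm ((𝓕 (ψ.toLp 2) : Lp ℂ 2 (volume : Measure ℝ))) (ENNReal.ofReal q) := by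
    rw [SchwartzMap.toLp_fourier_eq]
    exact eLpNorm_congr_ae ((𝓕 ψ : 𝓢(ℝ, ℂ)).coeFn_toLp 2 volume).symm
  have h2 : eLpNorm (fun ξ ↦ (bracket σ ξ : ℂ) * ψ.toLp 2 volume ξ) 2 =
      eLpNorm (fun ξ ↦ (bracket σ ξ : ℂ) * ψ ξ) 2 := by
    refine eLpNorm_congr_ae ?_
    filter_upwards [ψ.coeFn_toLp 2 volume] with ξ hξ
    rw [hξ]
  rw [h1, ← h2]
  exact h

lemma eLpNorm_fourier_schwartz_two (ψ : 𝓢(ℝ, ℂ)) :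
    eLpNorm (𝓕 ψ : 𝓢(ℝ, ℂ)) 2 = eLpNorm ψ 2 := by
  have h := SchwartzMap.norm_fourier_toL2_eq ψ
  rw [SchwartzMap.norm_toLp, SchwartzMap.norm_toLp] at h
  exact (ENNReal.toReal_eq_toReal_iff' ((𝓕 ψ : 𝓢(ℝ, ℂ)).memLp 2 volume).eLpNorm_ne_top
    (ψ.memLp 2 volume).eLpNorm_ne_top).1 h

lemma IsPowerNonlinearity.exists_abs_eq {p : ℝ} (hp : 1 < p) {f : ℝ → ℝ}
    (hf : IsPowerNonlinearity p f) : Continuous f ∧ ∃ k : ℝ, ∀ x, |f x| = k * |x| ^ p := by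
  rcases hf with ⟨k, hk, h⟩ | ⟨k, hk, h⟩
  · refine ⟨?_, k, fun x ↦ ?_⟩
    · rw [funext h]
      exact (continuous_const.mul continuous_id).mul
        (continuous_abs.rpow_const fun x ↦ Or.inr (by linarith))
    · rw [h, abs_mul, abs_mul, abs_of_pos hk, abs_of_nonneg (by positivity : 0 ≤ |x| ^ (p - 1)),
        mul_assoc]
      rcases eq_or_ne x 0 with rfl | hx
      · simp [Real.zero_rpow (by linarith : p ≠ 0)]
      · rw [← Real.rpow_one_add' (abs_nonneg _) (by linarith), add_sub_cancel]
  · refine ⟨?_, |k|, fun x ↦ ?_⟩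
    · rw [funext h]
      exact continuous_const.mul (continuous_abs.rpow_const fun x ↦ Or.inr (by linarith))
    · rw [h, abs_mul, abs_of_nonneg (by positivity : 0 ≤ |x| ^ p)]

lemma IsPowerNonlinearity.memLp_comp {p : ℝ} (hp : 1 < p) {f : ℝ → ℝ}
    (hf : IsPowerNonlinearity p f) {u : ℝ → ℝ} {b : ℝ} (hb : 0 < b)
    (hu : MemLp u (ENNReal.ofReal (b * p))) :
    MemLp (fun x ↦ f (u x)) (ENNReal.ofReal b) := by
  obtain ⟨hc, k, hk⟩ := hf.exists_abs_eq hp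
  have h1 : MemLp (fun x ↦ ‖u x‖ ^ p) (ENNReal.ofReal b) := by
    refine ⟨(hu.1.norm.aemeasurable.pow_const p).aestronglyMeasurable, ?_⟩
    rw [eLpNorm_norm_rpow u (by linarith), ← ENNReal.ofReal_mul hb.le]
    exact ENNReal.rpow_lt_top_of_nonneg (by linarith) hu.eLpNorm_ne_top
  refine h1.of_le_mul (c := k) (hc.comp_aestronglyMeasurable hu.1)
    (Eventually.of_forall fun x ↦ ?_)
  rw [Real.norm_eq_abs, hk, Real.norm_of_nonneg (by positivity), Real.norm_eq_abs]

/-! ### The bootstrap -/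

/-- One step of the bootstrap: either `H^s` is reached, or the regularity increases by an amount
that does not depend on `r`. With lossless embeddings the gain would be at least
`η = (1 + s - p (1 - s)) / 2`, which is positive exactly when `p` is below the critical exponent;
half of it is spent on the losses. -/
lemma bootstrap_step (hs : 0 < s) (hm : IsSymbol s m) {p : ℝ} (hp : 1 < p)
    (hη : 0 < 1 + s - p * (1 - s)) {f : ℝ → ℝ} (hf : IsPowerNonlinearity p f)
    {α β : ℝ} (hα : α ≠ 0) {u : Lp ℝ 2 (volume : Measure ℝ)}
    (heq : ∀ φ : 𝓢(ℝ, ℂ),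
      α * multiplier m u φ + β * pairing u φ - pairing (fun x ↦ f (u x)) φ = 0)
    {r : ℝ} (hr : s / 2 ≤ r) (hu : MemLp (fun ξ ↦ (bracket r ξ : ℂ) * hat u ξ) 2) :
    MemLp (fun ξ ↦ (bracket s ξ : ℂ) * hat u ξ) 2 ∨
      MemLp (fun ξ ↦ (bracket (r + (1 + s - p * (1 - s)) / 4) ξ : ℂ) * hat u ξ) 2 := by
  have hp0 : 0 < p := by linarith
  rcases lt_or_ge (1 / 2 - 1 / (2 * p)) r with h | h
  · left
    -- here `u ∈ L^(2p)`, so that `f(u) ∈ L²`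
    have hu' := memLp_of_memLp_bracket (a := 2 * p) (by linarith) h hu
    have hF : MemLp (fun x ↦ f (u x)) 2 := by
      simpa using hf.memLp_comp hp (b := 2) (by norm_num) hu'
    simpa using memLp_bracket_of_equation (q := 2) hs hm hα heq hF (le_refl (0 : ℝ))
      ⟨1, by simp, fun ψ ↦ by simp [bracket_zero, eLpNorm_fourier_schwartz_two]⟩
  · right
    -- here `s < 1`, and `f(u)` is only placed in an `L^b` with `1 < b < 2`
    set η := (1 + s - p * (1 - s)) / 2 with hηd
    have hη0 : 0 < η := by linarith
    -- the loss in the two embeddings; the total loss `(p + 1) ε` is half of the gain `η`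
    set ε := η / (2 * (p + 1)) with hε
    have hε0 : 0 < ε := by positivity
    have hεη : (p + 1) * ε = η / 2 := by rw [hε]; field_simp
    have hpinv : p * (1 / (2 * p)) = 1 / 2 := by field_simp
    have hpinv0 : 0 < 1 / (2 * p) := by positivity
    have hs1 : s < 1 := by linarith
    have hηs : η < s := by nlinarith
    have hεr : ε < r := by nlinarith
    set t := 1 / 2 - r + ε with ht
    have ht0 : 0 < t := by linarith
    have hpt : 1 / 2 < p * t := by nlinarith [mul_pos hp0 hε0]
    have hpt1 : p * t < 1 := by nlinarith
    have hu' : MemLp u (ENNReal.ofReal (1 / t)) := by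
      refine memLp_of_memLp_bracket (r := r) ?_ ?_ hu
      · rw [lt_div_iff₀ ht0]; linarith
      · rw [one_div_one_div]; linarith
    have hF : MemLp (fun x ↦ f (u x)) (ENNReal.ofReal (1 / (p * t))) := by
      refine hf.memLp_comp hp (by positivity) ?_
      convert hu' using 2
      field_simp
    have hq0 : 0 < 1 - p * t := by linarith
    have hσ : 1 / 2 - 1 / (1 / (1 - p * t)) < p * t - 1 / 2 + ε := by
      rw [one_div_one_div]; linarith
    have hq2 : 2 < 1 / (1 - p * t) := by rw [lt_div_iff₀ hq0]; linarith
    have : ENNReal.HolderConjugate (ENNReal.ofReal (1 / (p * t)))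
        (ENNReal.ofReal (1 / (1 - p * t))) := by
      constructor
      rw [← ENNReal.ofReal_inv_of_pos (by positivity), ← ENNReal.ofReal_inv_of_pos (by positivity),
        ← ENNReal.ofReal_add (by positivity) (by positivity)]
      simp
    refine memLp_bracket_mono ?_ (memLp_hat u).1 (memLp_bracket_of_equation hs hm hα heq hF
      (by linarith) (exists_eLpNorm_fourier_schwartz_le hq2 hσ))
    nlinarith

/-- Iterating the bootstrap reaches `H^s` after finitely many steps. -/
theorem memLp_bracket_of_solution (hs : 0 < s) (hm : IsSymbol s m) {p : ℝ} (hp : 1 < p)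
    (hη : 0 < 1 + s - p * (1 - s)) {f : ℝ → ℝ} (hf : IsPowerNonlinearity p f)
    {α β : ℝ} (hα : α ≠ 0) {u : Lp ℝ 2 (volume : Measure ℝ)}
    (heq : ∀ φ : 𝓢(ℝ, ℂ),
      α * multiplier m u φ + β * pairing u φ - pairing (fun x ↦ f (u x)) φ = 0)
    (hu : MemLp (fun ξ ↦ (bracket (s / 2) ξ : ℂ) * hat u ξ) 2) :
    MemLp (fun ξ ↦ (bracket s ξ : ℂ) * hat u ξ) 2 := by
  set δ := (1 + s - p * (1 - s)) / 4 with hδ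
  have hδ0 : 0 < δ := by positivity
  have key (n : ℕ) : MemLp (fun ξ ↦ (bracket s ξ : ℂ) * hat u ξ) 2 ∨
      MemLp (fun ξ ↦ (bracket (s / 2 + n * δ) ξ : ℂ) * hat u ξ) 2 := by
    induction n with
    | zero => right; simpa using hu
    | succ n ih =>
      rcases ih with h | h
      · exact Or.inl h
      · have := bootstrap_step hs hm hp hη hf hα heq
          (le_add_of_nonneg_right (by positivity)) h
        rwa [add_assoc, ← hδ, ← add_one_mul, ← Nat.cast_add_one] at this
  obtain ⟨n, hn⟩ := exists_nat_gt (s / 2 / δ)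
  rw [div_lt_iff₀ hδ0] at hn
  rcases key n with h | h
  · exact h
  · exact memLp_bracket_mono (by linarith) (memLp_hat u).1 h

end SolitaryWave

theorem theorem6p2 (s : ℝ) (hs : 0 < s) (m : ℝ → ℝ) (hm : SolitaryWave.IsSymbol s m)
    (p : ℝ) (hp : 1 < p) (hp' : s < 1 → p < (1 + s) / (1 - s))
    (f : ℝ → ℝ) (hf : SolitaryWave.IsPowerNonlinearity p f)
    (c : ℝ) (hc : c ≠ 0)
    (u : Lp ℝ 2 (volume : Measure ℝ)) (hu : SolitaryWave.MemH (s / 2) u)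
    (hsol : SolitaryWave.SolvesFirst m f c u ∨ SolitaryWave.SolvesSecond m f c u ∨
      SolitaryWave.SolvesThird m f c u) :
    SolitaryWave.MemH s u := by
  have hη : 0 < 1 + s - p * (1 - s) := by
    rcases lt_or_ge s 1 with h | h
    · have := hp' h
      rw [lt_div_iff₀ (by linarith)] at this
      linarith
    · nlinarith
  rw [SolitaryWave.memH_iff] at hu ⊢
  rcases hsol with h | h | h
  · refine SolitaryWave.memLp_bracket_of_solution (α := 1) (β := c) hs hm hp hη hf one_ne_zero
      (fun φ ↦ ?_) hu
    rw [← h φ]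
    push_cast
    ring
  · refine SolitaryWave.memLp_bracket_of_solution (α := c) (β := c) hs hm hp hη hf hc
      (fun φ ↦ ?_) hu
    rw [← h φ]
    ring
  · refine SolitaryWave.memLp_bracket_of_solution (α := c) (β := c - 1) hs hm hp hη hf hc
      (fun φ ↦ ?_) hu
    rw [← h φ]
    push_cast
    ring
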